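/- A robot searches for a stationary target at an unknown position $x$ on the real line, $|x|\ge 1$. It starts at the origin at time $0$ and at every moment moves, in either direction, at one of two speeds: the slow speed $v\in(0,1)$ or the fast speed $1$. It detects the target when it passes through the target's location at the slow speed, and it never detects the target while moving at the fast speed (detection probability $p=0$). The competitive ratio of a deterministic search strategy is the supremum, over all targets $x$ with $|x|\ge 1$, of (time at which the strategy detects a target at $x$)$/|x|$, where $|x|$ is the time in which the fast speed covers the distance from the origin to the target, and the ratio is $\infty$ if some target is never detected. Then for every $v\in(0,1)$, every deterministic two-speed search strategy has competitive ratio at least $$3+2\sqrt{2+\frac{2}{v}}+\frac{2}{v}.$$ -/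

import Mathlib

/-- A deterministic search strategy for a robot that starts at the origin of the line at time `0`
and at each instant moves, to the left or to the right, either at the slow speed `v` or at the fast
speed `1`.  The strategy is given by its signed velocity as a measurable function of time (only the
times `t ≥ 0` matter).  Until the target is found the robot learns nothing, so a deterministic
algorithm is the same thing as such a fixed motion plan. -/
structure TwoSpeedStrategy (v : ℝ) where
  /-- the signed velocity at each time -/
  velocity : ℝ → ℝ
  measurable_velocity : Measurable velocity
  two_speeds : ∀ t : ℝ, 0 ≤ t → |velocity t| = v ∨ |velocity t| = 1

namespace TwoSpeedStrategy

variable {v : ℝ}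

/-- The position of the robot at time `t`. -/
noncomputable def position (σ : TwoSpeedStrategy v) (t : ℝ) : ℝ :=
  ∫ s in (0 : ℝ)..t, σ.velocity s

/-- With detection probability `0` at the fast speed, a target at `x` is detected exactly at those
times at which the robot is at `x` while moving at the slow speed. -/
def DetectsAt (σ : TwoSpeedStrategy v) (x t : ℝ) : Prop :=
  0 ≤ t ∧ σ.position t = x ∧ |σ.velocity t| = v

/-- The time at which a target at `x` is found (`⊤` if it is never found). -/
noncomputable def searchTime (σ : TwoSpeedStrategy v) (x : ℝ) : ENNReal :=
  ⨅ (t : ℝ) (_ : σ.DetectsAt x t), ENNReal.ofReal t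

/-- The competitive ratio: the worst case, over all targets at distance at least `1` from the
origin, of the search time divided by the time `|x| / 1` that an agent who knows the
position `x` of the target needs to get there. -/
noncomputable def competitiveRatio (σ : TwoSpeedStrategy v) : ENNReal :=
  ⨆ (x : ℝ) (_ : 1 ≤ |x|), σ.searchTime x / ENNReal.ofReal |x|

end TwoSpeedStrategy

/-! Put k = 1/v - 1. Detecting a unit of length costs an extra time k beyond the path length,
because slow motion for time T detects length at most vT (`volume_detected_le`). A frontier is where
the contiguous detected part of a half-line ends; it must be revisited by time c times its distance
(`exists_return`), so the robot can be followed from one frontier to the opposite one and back,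
indefinitely. Bounding the path length below by the sum S of the frontiers so far (up to a constant)
gives `(k + 2) * r + 2 * S ≤ (c - 1 - k) * b`, where r is the frontier opposite when the robot
reaches b. For c below the claimed ratio, a quadratic with negative discriminant makes S / b rise by
a fixed amount at every step, while the inequality keeps it bounded (`IsSearch.not_lt`). -/

/-- The features of a line search used in the lower bound: the position `p`, the path length `len`
and the set `D t` of targets detected up to time `t`; exploring costs an extra time `k` per unit of
length, and every target `x` with `1 ≤ |x|` is found by time `c * |x|`. -/
structure IsSearch (p len : ℝ → ℝ) (D : ℝ → Set ℝ) (k c : ℝ) : Prop where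
  start : p 0 = 0
  abs_sub_le : ∀ s t, 0 ≤ s → s ≤ t → |p t - p s| ≤ len t - len s
  len_sub_le : ∀ s t, 0 ≤ s → s ≤ t → len t - len s ≤ t - s
  mono : ∀ s t, s ≤ t → D s ⊆ D t
  visited : ∀ t, ∀ x ∈ D t, ∃ s, 0 ≤ s ∧ s ≤ t ∧ p s = x
  found : ∀ x, 1 ≤ |x| → ∃ s, 0 ≤ s ∧ s ≤ c * |x| ∧ p s = x ∧ x ∈ D s
  explored : ∀ t a b, 0 ≤ t → 1 ≤ a → 1 ≤ b → (∀ y, 1 ≤ y → y < a → y ∈ D t) →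
    (∀ y, 1 ≤ y → y < b → -y ∈ D t) → len t + k * (a + b - 2) ≤ t

/-! ### Frontiers -/

/-- `r` is the end of the contiguous part of `[1, ∞)` that belongs to `A`. -/
structure IsFrontier (A : Set ℝ) (r : ℝ) : Prop where
  one_le : 1 ≤ r
  mem : ∀ y, 1 ≤ y → y < r → y ∈ A
  exists_notMem : ∀ ε, 0 < ε → ∃ y, r ≤ y ∧ y < r + ε ∧ y ∉ A

lemma IsFrontier.le_of_forall_le {A : Set ℝ} {r M : ℝ} (h : IsFrontier A r) (hM : 1 ≤ M)
    (hA : ∀ y ∈ A, y ≤ M) : r ≤ M := by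
  by_contra! hlt
  have := hA ((M + r) / 2) (h.mem _ (by linarith) (by linarith))
  linarith

lemma exists_isFrontier {A : Set ℝ} {M : ℝ} (hA : ∀ y ∈ A, y ≤ M) : ∃ r, IsFrontier A r := by
  let B : Set ℝ := {r | 1 ≤ r ∧ ∀ y, 1 ≤ y → y < r → y ∈ A}
  have h1 : (1 : ℝ) ∈ B := ⟨le_rfl, fun y h h' => absurd h' (not_lt.2 h)⟩
  have hbdd : BddAbove B := by
    refine ⟨max 1 M, fun r hr => ?_⟩
    by_contra! hlt
    obtain ⟨h2, h3⟩ := max_lt_iff.1 hlt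
    have := hA (max 1 ((M + r) / 2)) (hr.2 _ (le_max_left _ _) (max_lt h2 (by linarith)))
    have := le_max_right 1 ((M + r) / 2)
    linarith
  have hle : 1 ≤ sSup B := le_csSup hbdd h1
  have hmem : ∀ y, 1 ≤ y → y < sSup B → y ∈ A := fun y hy hlt => by
    obtain ⟨r, hr, hyr⟩ := exists_lt_of_lt_csSup ⟨1, h1⟩ hlt
    exact hr.2 y hy hyr
  refine ⟨sSup B, hle, hmem, fun ε hε => ?_⟩
  by_contra! hcon
  have : sSup B + ε ∈ B := by
    refine ⟨by linarith, fun y hy hlt => ?_⟩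
    rcases lt_or_ge y (sSup B) with h | h
    · exact hmem y hy h
    · exact hcon y h hlt
  have := le_csSup hbdd this
  linarith

/-! ### Geometry of an abstract line search -/

namespace IsSearch

variable {p len : ℝ → ℝ} {D : ℝ → Set ℝ} {k c : ℝ}

lemma neg (h : IsSearch p len D k c) :
    IsSearch (fun t => -p t) len (fun t => {x | -x ∈ D t}) k c where
  start := by simp [h.start]
  abs_sub_le s t hs hst := by
    have := h.abs_sub_le s t hs hst
    rwa [← abs_neg, show -(-p t - -p s) = p t - p s by ring]
  len_sub_le := h.len_sub_le
  mono s t hst x hx := h.mono s t hst hx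
  visited t x hx := by
    obtain ⟨s, h1, h2, h3⟩ := h.visited t _ hx
    exact ⟨s, h1, h2, by linarith⟩
  found x hx := by
    obtain ⟨s, h1, h2, h3, h4⟩ := h.found (-x) (by rwa [abs_neg])
    exact ⟨s, h1, by rwa [abs_neg] at h2, by linarith, h4⟩
  explored t a b ht ha hb h1 h2 := by
    have := h.explored t b a ht hb ha (fun y hy hy' => by simpa using h2 y hy hy')
      (fun y hy hy' => h1 y hy hy')
    linarith

lemma abs_sub_le_sub (h : IsSearch p len D k c) {s t : ℝ} (hs : 0 ≤ s) (hst : s ≤ t) :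
    |p t - p s| ≤ t - s :=
  (h.abs_sub_le s t hs hst).trans (h.len_sub_le s t hs hst)

lemma continuousOn (h : IsSearch p len D k c) : ContinuousOn p (Set.Ici 0) := by
  refine LipschitzOnWith.continuousOn (K := 1) (LipschitzOnWith.of_dist_le_mul ?_)
  intro s hs t ht
  rw [Real.dist_eq, Real.dist_eq, NNReal.coe_one, one_mul]
  rcases le_total s t with hst | hst
  · rw [abs_sub_comm, abs_sub_comm s t, abs_of_nonneg (sub_nonneg.2 hst)]
    exact h.abs_sub_le_sub hs hst
  · rw [abs_of_nonneg (sub_nonneg.2 hst)]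
    exact h.abs_sub_le_sub ht hst

lemma exists_frontier (h : IsSearch p len D k c) (t : ℝ) : ∃ r, IsFrontier (D t) r := by
  refine exists_isFrontier (M := t) fun y hy => ?_
  obtain ⟨s, hs, hst, rfl⟩ := h.visited t y hy
  have := h.abs_sub_le_sub le_rfl hs
  rw [h.start] at this
  linarith [le_abs_self (p s - 0)]

/-- After time `t` the robot has to come back to the frontier `r` by time `c * r`. -/
lemma exists_return (h : IsSearch p len D k c) (hc : 0 < c) {t r : ℝ} (ht : 0 ≤ t)
    (hr : IsFrontier (D t) r) : ∃ u, t ≤ u ∧ u ≤ c * r ∧ p u = r := by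
  -- Undetected points lie arbitrarily close to r, but r itself may be detected already; the limit
  -- yields a visit only.
  have key : ∀ ε, 0 < ε → ∃ y u, r ≤ y ∧ y < r + ε ∧ t < u ∧ u ≤ c * y ∧ p u = y := by
    intro ε hε
    obtain ⟨y, hry, hyr, hy⟩ := hr.exists_notMem ε hε
    have hy1 : 1 ≤ y := hr.one_le.trans hry
    obtain ⟨u, -, hu2, hu3, hu4⟩ := h.found y (by rwa [abs_of_nonneg (by linarith)])
    rw [abs_of_nonneg (by linarith)] at hu2
    refine ⟨y, u, hry, hyr, ?_, hu2, hu3⟩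
    by_contra! hut
    exact hy (h.mono u t hut hu4)
  have htr : t ≤ c * r := by
    refine le_of_forall_pos_le_add fun ε hε => ?_
    obtain ⟨y, u, -, h2, h3, h4, -⟩ := key (ε / c) (div_pos hε hc)
    have : c * y ≤ c * (r + ε / c) := by gcongr
    have e : c * (r + ε / c) = c * r + ε := by field_simp
    linarith
  have hcomp : IsCompact (p '' Set.Icc t (c * r)) :=
    isCompact_Icc.image_of_continuousOn (h.continuousOn.mono fun x hx => ht.trans hx.1)
  have hr' : r ∈ p '' Set.Icc t (c * r) := by
    rw [← hcomp.isClosed.closure_eq, Metric.mem_closure_iff]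
    intro ε hε
    obtain ⟨y, u, h1, h2, h3, h4, h5⟩ := key (ε / (c + 1)) (by positivity)
    have hlt : (c + 1) * (y - r) < ε := by
      have : y - r < ε / (c + 1) := by linarith
      rwa [lt_div_iff₀ (by positivity), mul_comm] at this
    -- u may exceed c * r by c * (y - r); truncating moves the position by at most that, hence the
    -- divisor c + 1.
    refine ⟨_, ⟨min u (c * r), ⟨le_min h3.le htr, min_le_right _ _⟩, rfl⟩, ?_⟩
    rw [Real.dist_eq]
    rcases le_total u (c * r) with hu | hu
    · rw [min_eq_left hu, h5, abs_sub_comm, abs_of_nonneg (by linarith)]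
      nlinarith
    · rw [min_eq_right hu]
      have := h.abs_sub_le_sub (ht.trans htr) hu
      rw [h5] at this
      rw [abs_lt]
      constructor <;> nlinarith [abs_le.1 this]
  obtain ⟨u, hu, rfl⟩ := hr'
  exact ⟨u, hu.1, hu.2, rfl⟩

/-- Crossing from `a` to `-b` while pushing the extremes from `-N, M` to `-N', M'`. -/
lemma exists_extremes (h : IsSearch p len D k c) {t u a b M N : ℝ} (ht : 0 ≤ t) (htu : t ≤ u)
    (hpt : p t = a) (hpu : p u = -b) (hab : 0 ≤ a + b) (haM : a ≤ M)
    (hbN : b ≤ N) :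
    ∃ M' N', M ≤ M' ∧ N ≤ N' ∧ (∀ s, t ≤ s → s ≤ u → -N' ≤ p s ∧ p s ≤ M') ∧
      a + b + 2 * (M' - M) + 2 * (N' - N) ≤ len u - len t := by
  have hcont : ContinuousOn p (Set.Icc t u) := h.continuousOn.mono fun x hx => ht.trans hx.1
  have hne : (Set.Icc t u).Nonempty := ⟨t, le_rfl, htu⟩
  obtain ⟨w, hw, hwmax⟩ := isCompact_Icc.exists_isMaxOn hne hcont
  obtain ⟨z, hz, hzmin⟩ := isCompact_Icc.exists_isMinOn hne hcont
  refine ⟨max M (p w), max N (-p z), le_max_left _ _, le_max_left _ _, fun s hs hs' => ⟨?_, ?_⟩, ?_⟩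
  · have : p z ≤ p s := hzmin ⟨hs, hs'⟩
    linarith [le_max_right N (-p z)]
  · have : p s ≤ p w := hwmax ⟨hs, hs'⟩
    linarith [le_max_right M (p w)]
  · have e1 : max M (p w) - M ≤ p w - a := by
      have : p t ≤ p w := hwmax ⟨le_rfl, htu⟩
      rcases max_cases M (p w) with ⟨e, _⟩ | ⟨e, _⟩ <;> rw [e] <;> linarith
    have e2 : max N (-p z) - N ≤ -p z - b := by
      have : p z ≤ p u := hzmin ⟨htu, le_rfl⟩
      rcases max_cases N (-p z) with ⟨e, _⟩ | ⟨e, _⟩ <;> rw [e] <;> linarith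
    have e3 : 0 ≤ p w - a := by
      have : p t ≤ p w := hwmax ⟨le_rfl, htu⟩
      linarith
    have e4 : 0 ≤ -p z - b := by
      have : p z ≤ p u := hzmin ⟨htu, le_rfl⟩
      linarith
    -- Maximum before minimum gives exactly the claimed bound; the other order costs 2 * (a + b)
    -- more.
    rcases le_total w z with hwz | hwz
    · have l1 := abs_le.1 (h.abs_sub_le t w ht hw.1)
      have l2 := abs_le.1 (h.abs_sub_le w z (ht.trans hw.1) hwz)
      have l3 := abs_le.1 (h.abs_sub_le z u (ht.trans hz.1) hz.2)
      linarith [l1.2, l2.1, l3.2]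
    · have l1 := abs_le.1 (h.abs_sub_le t z ht hz.1)
      have l2 := abs_le.1 (h.abs_sub_le z w (ht.trans hz.1) hwz)
      have l3 := abs_le.1 (h.abs_sub_le w u (ht.trans hw.1) hw.2)
      have : p z ≤ p t := hzmin ⟨le_rfl, htu⟩
      have : p u ≤ p w := hwmax ⟨htu, le_rfl⟩
      linarith [l1.1, l2.2, l3.1]

end IsSearch

/-! ### The chain of frontier visits -/

/-- At time `t` the robot is at the frontier `a` on the right, which it had to reach by time `c * a`,
the left frontier is `b`, the robot has stayed in `[-N, M]`, and the path length is bounded below in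
terms of `S`, the sum of all frontiers so far, up to a constant. -/
structure AtFrontier (p len : ℝ → ℝ) (D : ℝ → Set ℝ) (c t a b M N S : ℝ) : Prop where
  nonneg : 0 ≤ t
  le_mul : t ≤ c * a
  position_eq : p t = a
  one_le : 1 ≤ a
  mem : ∀ y, 1 ≤ y → y < a → y ∈ D t
  isFrontier : IsFrontier {x | -x ∈ D t} b
  le_left : a ≤ M
  le_right : b ≤ N
  mem_Icc : ∀ s, 0 ≤ s → s ≤ t → -N ≤ p s ∧ p s ≤ M
  le_len : 2 * S - a - 2 * b + 2 * M + 2 * N ≤ len t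

namespace AtFrontier

variable {p len : ℝ → ℝ} {D : ℝ → Set ℝ} {k c t a b M N S : ℝ}

lemma exists_initial (h : IsSearch p len D k c) (hc : 0 < c) :
    ∃ t a b M N S, AtFrontier p len D c t a b M N S := by
  have h0 : IsFrontier (D 0) 1 := by
    refine ⟨le_rfl, fun y h h' => absurd h' (not_lt.2 h), fun ε hε => ⟨1, le_rfl, by linarith, ?_⟩⟩
    intro h1
    obtain ⟨s, hs, hs', hp⟩ := h.visited 0 1 h1
    obtain rfl : s = 0 := le_antisymm hs' hs
    rw [h.start] at hp
    norm_num at hp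
  obtain ⟨t, ht, htc, hpt⟩ := h.exists_return hc le_rfl h0
  obtain ⟨b, hb⟩ := h.neg.exists_frontier t
  have hbd : ∀ s, 0 ≤ s → s ≤ t → -(t + 1) ≤ p s ∧ p s ≤ t + 1 := by
    intro s hs hst
    have := abs_le.1 (h.abs_sub_le_sub le_rfl hs)
    rw [h.start] at this
    constructor <;> linarith [this.1, this.2]
  -- S makes `le_len` an equality; it may be negative.
  refine ⟨t, 1, b, t + 1, t + 1, (len t + 1 + 2 * b - 4 * (t + 1)) / 2, ht, htc, hpt, le_rfl,
    fun y h h' => absurd h' (not_lt.2 h), hb, by linarith, ?_, hbd, by linarith⟩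
  refine hb.le_of_forall_le (by linarith) fun y hy => ?_
  obtain ⟨s, hs, hst, hps⟩ := h.visited t _ hy
  linarith [(hbd s hs hst).1]

/-- Pushing the extremes costs at least the increase of 2 * M + 2 * N, so the length bound survives
whatever r is. -/
lemma exists_next (h : IsSearch p len D k c) (hc : 0 < c)
    (H : AtFrontier p len D c t a b M N S) :
    ∃ u r M' N', AtFrontier (fun t => -p t) len (fun t => {x | -x ∈ D t}) c u b r N' M' (S + r) := by
  obtain ⟨u, htu, huc, hpu⟩ := h.neg.exists_return hc H.nonneg H.isFrontier
  have hpu' : p u = -b := by linarith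
  have hu : 0 ≤ u := H.nonneg.trans htu
  obtain ⟨M', N', hM, hN, hb, hlen⟩ :=
    h.exists_extremes H.nonneg htu H.position_eq hpu'
      (by linarith [H.one_le, H.isFrontier.one_le]) H.le_left H.le_right
  obtain ⟨r, hr⟩ := h.exists_frontier u
  have hIcc : ∀ s, 0 ≤ s → s ≤ u → -N' ≤ p s ∧ p s ≤ M' := by
    intro s hs hsu
    rcases le_total s t with hst | hst
    · have := H.mem_Icc s hs hst
      constructor <;> linarith [this.1, this.2]
    · exact hb s hst hsu
  refine ⟨u, r, M', N', hu, huc, hpu, H.isFrontier.one_le, fun y h1 h2 => ?_, ?_,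
    H.le_right.trans hN, ?_, fun s hs hsu => ?_, ?_⟩
  · exact h.mono t u htu (H.isFrontier.mem y h1 h2)
  · simpa using hr
  · refine hr.le_of_forall_le (by linarith [H.one_le, H.le_left]) fun y hy => ?_
    obtain ⟨s, hs, hsu, rfl⟩ := h.visited u y hy
    exact (hIcc s hs hsu).2
  · have := hIcc s hs hsu
    constructor <;> linarith [this.1, this.2]
  · linarith [H.le_len]

lemma le_mul_sub (h : IsSearch p len D k c) (H : AtFrontier p len D c t a b M N S) :
    2 * S + a + k * (a + b - 2) ≤ c * a := by
  have := h.explored t a b H.nonneg H.one_le H.isFrontier.one_le H.mem H.isFrontier.mem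
  linarith [H.le_mul, H.le_len, H.le_left, H.le_right]

end AtFrontier

/-! ### The recurrence and its contradiction -/

/-- A state on either side of the origin. -/
def FrontierState (k c a b S : ℝ) : Prop :=
  ∃ p len D t M N, IsSearch p len D k c ∧ AtFrontier p len D c t a b M N (S + k)

lemma FrontierState.one_le {k c a b S : ℝ} (H : FrontierState k c a b S) : 1 ≤ b := by
  obtain ⟨p, len, D, t, M, N, h, H⟩ := H
  exact H.isFrontier.one_le

lemma FrontierState.exists_next {k c a b S : ℝ} (hc : 0 < c) (H : FrontierState k c a b S) :
    ∃ r, FrontierState k c b r (S + r) ∧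
      2 * (S + r) + b + k * (b + r) ≤ c * b := by
  obtain ⟨p, len, D, t, M, N, h, H⟩ := H
  obtain ⟨u, r, M', N', H'⟩ := H.exists_next h hc
  refine ⟨r, ⟨_, _, _, u, _, _, h.neg, by rwa [add_right_comm]⟩, ?_⟩
  -- The shift of S by k cancels the -2 * k due to targets within distance 1.
  have := H'.le_mul_sub h.neg
  linarith

/-- The discriminant is `(K - a - 2) ^ 2 - 8 * a`; `h1` allows squaring `h2`, and δ is the minimum
value. -/
lemma quadratic_lower_bound {a K : ℝ} (ha : 0 < a) (h1 : a + 2 ≤ K)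
    (h2 : K < a + 2 + 2 * √(2 * a)) :
    ∃ δ, 0 < δ ∧ ∀ x, δ ≤ 2 * x ^ 2 + (a - 2 - K) * x + K := by
  refine ⟨(8 * K - (K + 2 - a) ^ 2) / 8, ?_, fun x => ?_⟩
  · have hs : √(2 * a) ^ 2 = 2 * a := Real.sq_sqrt (by positivity)
    have hs0 : 0 ≤ √(2 * a) := Real.sqrt_nonneg _
    have : (K - a - 2) ^ 2 < 8 * a := by nlinarith
    have : 0 < 8 * K - (K + 2 - a) ^ 2 := by nlinarith
    positivity
  · nlinarith [sq_nonneg (4 * x + (a - 2 - K))]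

/-- No search has a competitive ratio below `3 + 2 * √(4 + 2 * k) + 2 * (k + 1)`. -/
theorem IsSearch.not_lt {p len : ℝ → ℝ} {D : ℝ → Set ℝ} {k c : ℝ} (hk : 0 ≤ k) (hc : 0 < c)
    (h : IsSearch p len D k c) : ¬ c < 3 + 2 * √(2 * (k + 2)) + 2 * (k + 1) := by
  intro hlt
  -- Raising K to k + 4 only weakens the recurrence and secures `h1` of the quadratic lemma.
  set K := max (k + 2 + 2) (c - 1 - k) with hK
  have hK0 : 0 < K := lt_of_lt_of_le (by linarith) (le_max_left _ _)
  have hsq : 0 < √(2 * (k + 2)) := Real.sqrt_pos.2 (by linarith)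
  obtain ⟨δ, hδ, hquad⟩ := quadratic_lower_bound (a := k + 2) (K := K) (by linarith)
    (le_max_left _ _) (max_lt (by linarith) (by linarith))
  have next : ∀ a b S, FrontierState k c a b S →
      ∃ r, FrontierState k c b r (S + r) ∧ (k + 2) * r + 2 * S ≤ K * b := by
    intro a b S H
    obtain ⟨r, hr, hle⟩ := H.exists_next hc
    refine ⟨r, hr, ?_⟩
    have : (c - 1 - k) * b ≤ K * b :=
      mul_le_mul_of_nonneg_right (le_max_right _ _) (by linarith [H.one_le])
    linarith
  obtain ⟨t, a₀, b₀, M, N, S₀, H₀⟩ := AtFrontier.exists_initial h hc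
  -- S may start negative, but each step adds r ≥ 1.
  have large : ∀ n : ℕ, ∃ a b S, FrontierState k c a b S ∧ S₀ - k + n ≤ S := by
    intro n
    induction n with
    | zero => exact ⟨a₀, b₀, S₀ - k, ⟨p, len, D, t, M, N, h, by simpa using H₀⟩, by simp⟩
    | succ n ih =>
      obtain ⟨a, b, S, H, hS⟩ := ih
      obtain ⟨r, hr, -⟩ := next a b S H
      refine ⟨_, _, _, hr, ?_⟩
      push_cast
      linarith [hr.one_le]
  have growth : ∀ n : ℕ, ∃ a b S, FrontierState k c a b S ∧ 0 < S ∧ n * (δ / K) * b ≤ S := by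
    intro n
    induction n with
    | zero =>
      obtain ⟨n, hn⟩ := exists_nat_gt (k - S₀)
      obtain ⟨a, b, S, H, hS⟩ := large n
      exact ⟨a, b, S, H, by linarith, by simp; linarith⟩
    | succ n ih =>
      obtain ⟨a, b, S, H, hS0, hS⟩ := ih
      obtain ⟨r, hr, hle⟩ := next a b S H
      have hb := H.one_le
      have hr1 := hr.one_le
      refine ⟨_, _, _, hr, by linarith, ?_⟩
      set x := S / b with hx
      have hSx : S = x * b := by rw [hx]; field_simp
      have hx0 : 0 < x := by positivity
      have hnx : n * (δ / K) ≤ x := by rwa [hx, le_div_iff₀ (by linarith)]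
      have h1 : (k + 2) * r ≤ (K - 2 * x) * b := by rw [hSx] at hle; linarith
      have hpos : 0 < K - 2 * x := by
        by_contra! hneg
        nlinarith
      -- The next ratio (S + r) / r is at least 1 + (k + 2) * x / (K - 2 * x), and this is at least
      -- x + δ / K.
      have h2 : (x + δ / K) * (K - 2 * x) ≤ (K - 2 * x) + (k + 2) * x := by
        have e1 : δ / K * (K - 2 * x) ≤ δ := by
          rw [div_mul_eq_mul_div, div_le_iff₀ hK0]
          nlinarith
        nlinarith [hquad x]
      have h3 : (x + δ / K) * r ≤ S + r := by
        have e2 : (x + δ / K) * (K - 2 * x) * r ≤ (K - 2 * x) * (S + r) := by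
          calc (x + δ / K) * (K - 2 * x) * r ≤ ((K - 2 * x) + (k + 2) * x) * r := by gcongr
            _ = (K - 2 * x) * r + x * ((k + 2) * r) := by ring
            _ ≤ (K - 2 * x) * r + x * ((K - 2 * x) * b) := by gcongr
            _ = (K - 2 * x) * (S + r) := by rw [hSx]; ring
        refine le_of_mul_le_mul_left ?_ hpos
        linarith
      push_cast
      calc ((n : ℝ) + 1) * (δ / K) * r = (n * (δ / K) + δ / K) * r := by ring
        _ ≤ (x + δ / K) * r := by gcongr
        _ ≤ S + r := h3
  -- The recurrence forces S / b < K / 2, so growth past K is absurd.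
  obtain ⟨n, hn⟩ := exists_nat_gt (K / (δ / K))
  obtain ⟨a, b, S, H, hS0, hS⟩ := growth n
  obtain ⟨r, hr, hle⟩ := next a b S H
  have hb := H.one_le
  have hr1 := hr.one_le
  rw [div_lt_iff₀ (by positivity)] at hn
  have : K * b ≤ n * (δ / K) * b := by gcongr
  nlinarith

/-! ### Slow time bounds the detected length -/

open MeasureTheory Set in
/-- The image under a `1`-Lipschitz function of a set on which the derivative is at most `v` in
absolute value almost everywhere. -/
lemma volume_image_le_of_ae_hasDerivAt {f f' : ℝ → ℝ} {A : Set ℝ} {v : ℝ} (hA : MeasurableSet A)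
    (hf : LipschitzOnWith 1 f A) (hderiv : ∀ᵐ x, x ∈ A → HasDerivAt f (f' x) x)
    (hv : ∀ x ∈ A, |f' x| ≤ v) : volume (f '' A) ≤ ENNReal.ofReal v * volume A := by
  obtain ⟨Z, hZ, hZm, hZ0⟩ := exists_measurable_superset_of_null (ae_iff.1 hderiv)
  have h1 : volume (f '' (A \ Z)) ≤ ENNReal.ofReal v * volume A := by
    calc volume (f '' (A \ Z))
        ≤ ∫⁻ x in A \ Z, ENNReal.ofReal
            |(ContinuousLinearMap.toSpanSingleton ℝ (f' x) : ℝ →L[ℝ] ℝ).det| := by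
          refine addHaar_image_le_lintegral_abs_det_fderiv volume (hA.diff hZm) fun x hx => ?_
          have : HasDerivAt f (f' x) x := by
            by_contra hcon
            exact hx.2 (hZ fun h => hcon (h hx.1))
          exact this.hasFDerivAt.hasFDerivWithinAt
      _ ≤ ∫⁻ _ in A \ Z, ENNReal.ofReal v := by
          refine setLIntegral_mono measurable_const fun x hx => ENNReal.ofReal_le_ofReal ?_
          rw [ContinuousLinearMap.det_toSpanSingleton]
          exact hv x hx.1
      _ ≤ ENNReal.ofReal v * volume A := by
          rw [setLIntegral_const]
          gcongr
          exact sdiff_subset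
  -- Lipschitz maps send null sets to null sets.
  have h2 : volume (f '' (A ∩ Z)) = 0 := by
    have := (hf.mono inter_subset_left : LipschitzOnWith 1 f (A ∩ Z)).hausdorffMeasure_image_le
      zero_le_one
    rw [hausdorffMeasure_real] at this
    have hz : volume (A ∩ Z) = 0 := measure_mono_null inter_subset_right hZ0
    simpa [hz] using this
  calc volume (f '' A) = volume (f '' (A \ Z) ∪ f '' (A ∩ Z)) := by
        rw [← image_union, sdiff_union_inter]
    _ ≤ volume (f '' (A \ Z)) + volume (f '' (A ∩ Z)) := measure_union_le _ _
    _ ≤ ENNReal.ofReal v * volume A := by rw [h2, add_zero]; exact h1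

namespace TwoSpeedStrategy

open MeasureTheory Set

variable {v : ℝ}

/-- The length of the path up to time `t`. -/
noncomputable def pathLength (σ : TwoSpeedStrategy v) (t : ℝ) : ℝ :=
  ∫ s in (0 : ℝ)..t, |σ.velocity s|

/-- The slow times up to time `t`. -/
def slowTimes (σ : TwoSpeedStrategy v) (t : ℝ) : Set ℝ :=
  {s | |σ.velocity s| = v} ∩ Icc 0 t

/-- The targets detected up to time `t`. -/
def detected (σ : TwoSpeedStrategy v) (t : ℝ) : Set ℝ :=
  {x | ∃ s ≤ t, σ.DetectsAt x s}

lemma abs_velocity_le_one (σ : TwoSpeedStrategy v) (hv1 : v < 1) {t : ℝ} (ht : 0 ≤ t) :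
    |σ.velocity t| ≤ 1 := by
  rcases σ.two_speeds t ht with h | h <;> linarith

lemma intervalIntegrable_velocity (σ : TwoSpeedStrategy v) (hv1 : v < 1) {s t : ℝ} (hs : 0 ≤ s)
    (ht : 0 ≤ t) : IntervalIntegrable σ.velocity volume s t := by
  refine (intervalIntegrable_const (c := (1 : ℝ))).mono_fun
    σ.measurable_velocity.aestronglyMeasurable ?_
  refine (ae_restrict_iff' measurableSet_uIoc).2 (ae_of_all _ fun x hx => ?_)
  simpa using σ.abs_velocity_le_one hv1 ((le_min hs ht).trans hx.1.le)

lemma position_sub (σ : TwoSpeedStrategy v) (hv1 : v < 1) {s t : ℝ} (hs : 0 ≤ s) (ht : 0 ≤ t) :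
    σ.position t - σ.position s = ∫ u in s..t, σ.velocity u :=
  intervalIntegral.integral_interval_sub_left (σ.intervalIntegrable_velocity hv1 le_rfl ht)
    (σ.intervalIntegrable_velocity hv1 le_rfl hs)

lemma pathLength_sub (σ : TwoSpeedStrategy v) (hv1 : v < 1) {s t : ℝ} (hs : 0 ≤ s) (ht : 0 ≤ t) :
    σ.pathLength t - σ.pathLength s = ∫ u in s..t, |σ.velocity u| :=
  intervalIntegral.integral_interval_sub_left (σ.intervalIntegrable_velocity hv1 le_rfl ht).abs
    (σ.intervalIntegrable_velocity hv1 le_rfl hs).abs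

lemma abs_position_sub_le (σ : TwoSpeedStrategy v) (hv1 : v < 1) {s t : ℝ} (hs : 0 ≤ s)
    (hst : s ≤ t) : |σ.position t - σ.position s| ≤ σ.pathLength t - σ.pathLength s := by
  rw [σ.position_sub hv1 hs (hs.trans hst), σ.pathLength_sub hv1 hs (hs.trans hst)]
  exact intervalIntegral.abs_integral_le_integral_abs hst

lemma pathLength_sub_le (σ : TwoSpeedStrategy v) (hv1 : v < 1) {s t : ℝ} (hs : 0 ≤ s)
    (hst : s ≤ t) : σ.pathLength t - σ.pathLength s ≤ t - s := by
  rw [σ.pathLength_sub hv1 hs (hs.trans hst)]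
  have := intervalIntegral.integral_mono_on hst
    (σ.intervalIntegrable_velocity hv1 hs (hs.trans hst)).abs
    (intervalIntegrable_const (c := (1 : ℝ)))
    fun x hx => σ.abs_velocity_le_one hv1 (hs.trans hx.1)
  simpa using this

lemma measurableSet_slowTimes (σ : TwoSpeedStrategy v) (t : ℝ) :
    MeasurableSet (σ.slowTimes t) :=
  (measurableSet_eq_fun (by simpa using σ.measurable_velocity.norm) measurable_const).inter
    measurableSet_Icc

lemma volume_slowTimes_ne_top (σ : TwoSpeedStrategy v) (t : ℝ) :
    volume (σ.slowTimes t) ≠ ⊤ :=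
  measure_ne_top_of_subset inter_subset_right (by simp)

lemma pathLength_eq (σ : TwoSpeedStrategy v) {t : ℝ} (ht : 0 ≤ t) :
    σ.pathLength t = t - (1 - v) * (volume (σ.slowTimes t)).toReal := by
  have hS : MeasurableSet {s | |σ.velocity s| = v} :=
    measurableSet_eq_fun (by simpa using σ.measurable_velocity.norm) measurable_const
  have h1 : ∫ s in Icc 0 t, |σ.velocity s| =
      ∫ s in Icc 0 t, (1 - {s | |σ.velocity s| = v}.indicator (fun _ => 1 - v) s) := by
    refine setIntegral_congr_fun measurableSet_Icc fun s hs => ?_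
    by_cases h : |σ.velocity s| = v
    · simp [indicator, h]
    · rw [(σ.two_speeds s hs.1).resolve_left h]
      simp only [indicator, mem_ofPred_eq, if_neg h, sub_zero]
  have hint : IntegrableOn ({s | |σ.velocity s| = v}.indicator (fun _ => 1 - v)) (Icc 0 t) :=
    (integrableOn_const (by simp)).indicator hS
  have hconst : IntegrableOn (fun _ => (1 : ℝ)) (Icc 0 t) := integrableOn_const (by simp)
  rw [pathLength, intervalIntegral.integral_of_le ht, ← integral_Icc_eq_integral_Ioc, h1,
    integral_sub hconst hint, setIntegral_indicator hS, setIntegral_const,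
    setIntegral_const]
  rw [measureReal_def, measureReal_def, Real.volume_Icc, inter_comm (Icc 0 t), slowTimes]
  simp [ht, mul_comm]

lemma detected_eq (σ : TwoSpeedStrategy v) (t : ℝ) :
    σ.detected t = σ.position '' σ.slowTimes t := by
  ext x
  constructor
  · rintro ⟨s, hst, hs, hx, hv⟩
    exact ⟨s, ⟨hv, hs, hst⟩, hx⟩
  · rintro ⟨s, ⟨hv, hs, hst⟩, hx⟩
    exact ⟨s, hst, hs, hx, hv⟩

/-- By Lebesgue differentiation the position has derivative `velocity` almost everywhere, of size v
at slow times. -/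
lemma volume_detected_le (σ : TwoSpeedStrategy v) (hv1 : v < 1) {t : ℝ} (ht : 0 ≤ t) :
    volume (σ.detected t) ≤ ENNReal.ofReal v * volume (σ.slowTimes t) := by
  rw [detected_eq]
  refine volume_image_le_of_ae_hasDerivAt (f' := σ.velocity) (σ.measurableSet_slowTimes t) ?_ ?_
    fun x hx => hx.1.le
  · refine LipschitzOnWith.of_dist_le_mul fun x hx y hy => ?_
    have key : ∀ x y, 0 ≤ x → x ≤ y → |σ.position y - σ.position x| ≤ y - x := fun x y hx hxy =>
      (σ.abs_position_sub_le hv1 hx hxy).trans (σ.pathLength_sub_le hv1 hx hxy)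
    rw [Real.dist_eq, Real.dist_eq, NNReal.coe_one, one_mul]
    rcases le_total x y with h | h
    · rw [abs_sub_comm, abs_sub_comm x y, abs_of_nonneg (sub_nonneg.2 h)]
      exact key x y hx.2.1 h
    · rw [abs_of_nonneg (sub_nonneg.2 h)]
      exact key y x hy.2.1 h
  · filter_upwards [(σ.intervalIntegrable_velocity hv1 le_rfl ht).ae_hasDerivAt_integral]
      with x hx hxS
    rw [uIcc_of_le ht] at hx
    exact hx hxS.2 0 ⟨le_rfl, ht⟩

lemma isSearch (σ : TwoSpeedStrategy v) (hv0 : 0 < v) (hv1 : v < 1) {c : ℝ}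
    (hc : ∀ x, 1 ≤ |x| → ∃ t, σ.DetectsAt x t ∧ t ≤ c * |x|) :
    IsSearch σ.position σ.pathLength σ.detected (1 / v - 1) c where
  start := by simp [position]
  abs_sub_le s t hs hst := σ.abs_position_sub_le hv1 hs hst
  len_sub_le s t hs hst := σ.pathLength_sub_le hv1 hs hst
  mono s t hst := fun x ⟨u, hu, h⟩ => ⟨u, hu.trans hst, h⟩
  visited t := fun x ⟨s, hst, hs, hx, _⟩ => ⟨s, hs, hst, hx⟩
  found x hx := by
    obtain ⟨t, ht, htc⟩ := hc x hx
    exact ⟨t, ht.1, htc, ht.2.1, t, le_rfl, ht⟩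
  explored t a b ht ha hb hA hB := by
    have hsub : Ico 1 a ∪ Ioc (-b) (-1) ⊆ σ.detected t := by
      rintro y (hy | hy)
      · exact hA y hy.1 hy.2
      · simpa using hB (-y) (by linarith [hy.2]) (by linarith [hy.1])
    have hdisj : Disjoint (Ico 1 a) (Ioc (-b) (-1)) := by
      rw [Set.disjoint_left]
      intro y h1 h2
      linarith [h1.1, h2.2]
    have hvol : ENNReal.ofReal (a + b - 2) ≤ ENNReal.ofReal v * volume (σ.slowTimes t) := by
      refine le_trans (le_of_eq ?_) ((measure_mono hsub).trans (σ.volume_detected_le hv1 ht))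
      rw [measure_union hdisj measurableSet_Ioc, Real.volume_Ico, Real.volume_Ioc,
        ← ENNReal.ofReal_add (by linarith) (by linarith)]
      congr 1
      ring
    rw [ENNReal.ofReal_le_iff_le_toReal
      (ENNReal.mul_ne_top ENNReal.ofReal_ne_top (σ.volume_slowTimes_ne_top t)),
      ENNReal.toReal_mul, ENNReal.toReal_ofReal hv0.le] at hvol
    rw [σ.pathLength_eq ht]
    -- With slow time T, t minus the path length is (1 - v) * T = k * (v * T).
    have : (1 / v - 1) * (a + b - 2) ≤ (1 / v - 1) * (v * (volume (σ.slowTimes t)).toReal) :=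
      mul_le_mul_of_nonneg_left hvol (by rw [sub_nonneg, le_div_iff₀ hv0]; linarith)
    have e : (1 / v - 1) * (v * (volume (σ.slowTimes t)).toReal) =
        (1 - v) * (volume (σ.slowTimes t)).toReal := by field_simp
    linarith

lemma exists_detectsAt_of_competitiveRatio_lt (σ : TwoSpeedStrategy v) {c x : ℝ}
    (h : σ.competitiveRatio < ENNReal.ofReal c) (hx : 1 ≤ |x|) :
    ∃ t, σ.DetectsAt x t ∧ t ≤ c * |x| := by
  have hx0 : 0 < |x| := by linarith
  have h1 : σ.searchTime x / ENNReal.ofReal |x| < ENNReal.ofReal c :=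
    lt_of_le_of_lt (le_iSup₂ (f := fun (x : ℝ) (_ : 1 ≤ |x|) =>
      σ.searchTime x / ENNReal.ofReal |x|) x hx) h
  rw [ENNReal.div_lt_iff (Or.inl (by simpa using hx0.ne')) (Or.inl ENNReal.ofReal_ne_top),
    ← ENNReal.ofReal_mul' hx0.le, searchTime, iInf_lt_iff] at h1
  obtain ⟨t, ht⟩ := h1
  obtain ⟨hd, hlt⟩ := iInf_lt_iff.1 ht
  exact ⟨t, hd, (ENNReal.ofReal_lt_ofReal_iff'.1 hlt).1.le⟩

end TwoSpeedStrategy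

theorem theorem3 (v : ℝ) (hv0 : 0 < v) (hv1 : v < 1) (σ : TwoSpeedStrategy v) :
    ENNReal.ofReal (3 + 2 * Real.sqrt (2 + 2 / v) + 2 / v) ≤ σ.competitiveRatio := by
  by_contra! hlt
  obtain ⟨c, hc, hcB⟩ := ENNReal.lt_iff_exists_real_btwn.1 hlt |>.imp fun c h => h.2
  have hc0 : 0 < c := ENNReal.ofReal_pos.1 (lt_of_le_of_lt zero_le hc)
  have hcB' := (ENNReal.ofReal_lt_ofReal_iff'.1 hcB).1
  have hk : 0 ≤ 1 / v - 1 := by rw [sub_nonneg, le_div_iff₀ hv0]; linarith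
  refine (σ.isSearch hv0 hv1 fun x hx =>
    σ.exists_detectsAt_of_competitiveRatio_lt hc hx).not_lt hk hc0 ?_
  have e : 2 * (1 / v - 1 + 2) = 2 + 2 / v := by ring
  rw [e]
  have : 2 * (1 / v - 1 + 1) = 2 / v := by ring
  linarith
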